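/- Let $E=(E^0,E^1,r,s)$ be a directed graph, with vertex set $E^0$, edge set $E^1$, and range and source maps $r,s\colon E^1\to E^0$. Assume that $E$ is row-finite, that is, that $s^{-1}(v)$ is finite for every $v\in E^0$. Let $M_E$ be the abelian monoid given by the generators $\{a_v\mid v\in E^0\}$ and the relations $$a_v=\sum_{\{e\in E^1\mid s(e)=v\}}a_{r(e)}\qquad\text{for every } v\in E^0 \text{ that emits at least one edge (i.e. } s^{-1}(v)\neq\emptyset).$$ Equip $M_E$ with its algebraic pre-order: $x\le y$ if and only if there is $z\in M_E$ with $y=x+z$. Then $M_E$ is unperforated: for all $a,b\in M_E$ and all positive integers $n$, if $na\le nb$, then $a\le b$. -/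

import Mathlib

universe u v

/-- A directed graph: a vertex set `V`, an edge set `Edge`, and source and range maps
(loops and multiple edges are allowed). -/
structure DirGraph (V : Type u) (Edge : Type v) where
  src : Edge → V
  rng : Edge → V

namespace DirGraph

/-- `v` emits edges if it is the source of at least one edge. -/
def Emits {V : Type u} {Edge : Type v} (E : DirGraph V Edge) (x : V) : Prop :=
  ∃ e : Edge, E.src e = x

/-- A graph is row-finite if every vertex emits only finitely many edges. -/
def RowFinite {V : Type u} {Edge : Type v} (E : DirGraph V Edge) : Prop :=
  ∀ x : V, {e : Edge | E.src e = x}.Finite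

/-- The element `∑_{s(e) = x} r(e)` of the free abelian monoid `V →₀ ℕ` on the vertices. -/
noncomputable def outSum {V : Type u} {Edge : Type v} (E : DirGraph V Edge)
    (hE : E.RowFinite) (x : V) : V →₀ ℕ :=
  ∑ e ∈ (hE x).toFinset, Finsupp.single (E.rng e) 1

/-- The defining relations of the graph monoid: `x = ∑_{s(e) = x} r(e)` for every vertex `x`
that emits edges. -/
inductive GraphRel {V : Type u} {Edge : Type v} (E : DirGraph V Edge) (hE : E.RowFinite) :
    (V →₀ ℕ) → (V →₀ ℕ) → Prop
  | of_emits (x : V) (hx : E.Emits x) : GraphRel E hE (Finsupp.single x 1) (E.outSum hE x)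

/-- The graph monoid `M_E`: the abelian monoid with generators the vertices and the relations
`GraphRel`, that is, the quotient of the free abelian monoid on the vertices by the congruence
that these relations generate. -/
abbrev graphMonoid {V : Type u} {Edge : Type v} (E : DirGraph V Edge) (hE : E.RowFinite) :
    Type u :=
  (addConGen (GraphRel E hE)).Quotient

end DirGraph

/-- The algebraic preorder of an abelian monoid: `x ≤ y` iff `y = x + z` for some `z`. -/
def AlgLE {M : Type u} [AddCommMonoid M] (x y : M) : Prop :=
  ∃ z : M, y = x + z

/-- An abelian monoid is unperforated if `n a ≤ n b` implies `a ≤ b`, for all elements `a`, `b`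
and all positive integers `n`, where `≤` is the algebraic preorder. -/
def IsUnperforated (M : Type u) [AddCommMonoid M] : Prop :=
  ∀ (a b : M) (n : ℕ), 0 < n → AlgLE (n • a) (n • b) → AlgLE a b

/-!
For a set `S` of vertices, consider the monoid generated by all vertices with one relation
`v = out v` for each `v ∈ S`.

* If every `out v` contains `v`, then, for fixed `b` and `n`, the property of `y` that
  `y ≤ n • c` pointwise for some `c` equal to `b` in the monoid survives replacing `v` by `out v`
  in `y`, since `c` may then be replaced by `c + (out v - v)`. It holds for `y = n • b`, hence for
  `y = n • a + z` if `n • a + z` and `n • b` are equal in the monoid, and `n • a ≤ n • c` gives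
  `a ≤ c`.
* If `out v` does not contain `v`, the generator `v` can be eliminated: substituting `out v` for
  `v` in the other relations presents the same monoid with one relation fewer. For finite `S`,
  repeated elimination ends in the first case.
* An equality between two elements uses only finitely many relations.
-/

theorem AlgLE.map {M N : Type*} [AddCommMonoid M] [AddCommMonoid N] (f : M →+ N) {x y : M} :
    AlgLE x y → AlgLE (f x) (f y) := by
  rintro ⟨z, rfl⟩
  exact ⟨f z, map_add f x z⟩

theorem IsUnperforated.of_leftInverse {M N : Type*} [AddCommMonoid M] [AddCommMonoid N]
    (hN : IsUnperforated N) {f : M →+ N} {g : N →+ M} (hgf : Function.LeftInverse g f) :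
    IsUnperforated M := by
  intro a b n hn hab
  have hfab : AlgLE (f a) (f b) := hN _ _ n hn (by simpa only [map_nsmul] using hab.map f)
  simpa only [hgf a, hgf b] using hfab.map g

theorem isUnperforated_quotient_iff {M : Type*} [AddCommMonoid M] {C : AddCon M} :
    IsUnperforated C.Quotient ↔
      ∀ ⦃a b z : M⦄ ⦃n : ℕ⦄, 0 < n → C (n • b) (n • a + z) → ∃ z', C b (a + z') := by
  have algLE_iff (x y : M) : AlgLE (x : C.Quotient) y ↔ ∃ z, C y (x + z) := by
    simp only [AlgLE, C.mk'_surjective.exists, AddCon.coe_mk', ← AddCon.coe_add, AddCon.eq]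
  simp only [IsUnperforated, C.mk'_surjective.forall, AddCon.coe_mk', algLE_iff]
  exact ⟨fun h a b z n hn hab => h a b n hn ((algLE_iff (n • a) (n • b)).2 ⟨z, hab⟩),
    fun h a b n hn hab => ((algLE_iff (n • a) (n • b)).1 hab).elim fun _ hz => h hn hz⟩

theorem iff_of_addConGen {M : Type*} [AddCommMonoid M] {r : M → M → Prop} {P : M → Prop}
    (hP : ∀ x y, r x y → ∀ c, P (x + c) ↔ P (y + c)) {x y : M} (hxy : addConGen r x y) :
    P x ↔ P y := by
  let C : AddCon M :=
    { r x y := ∀ c, P (x + c) ↔ P (y + c)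
      iseqv := ⟨fun _ _ => Iff.rfl, fun h c => (h c).symm, fun h h' c => (h c).trans (h' c)⟩
      add' {w x y z} hwx hyz c := by
        rw [add_assoc, hwx, add_left_comm, hyz, add_left_comm, add_assoc] }
  have hC : C x y := AddCon.addConGen_le (c := C).2 hP hxy
  simpa only [add_zero] using hC 0

theorem exists_finset_of_addConGen {M ι : Type*} [Add M] {R : ι → M → M → Prop} {S : Set ι}
    {x y : M} (h : addConGen (fun x y => ∃ i ∈ S, R i x y) x y) :
    ∃ T : Finset ι, ↑T ⊆ S ∧ addConGen (fun x y => ∃ i ∈ (T : Set ι), R i x y) x y := by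
  classical
  let C (T : Finset ι) : AddCon M := addConGen fun x y => ∃ i ∈ (T : Set ι), R i x y
  have C_mono {T U : Finset ι} (hTU : T ⊆ U) : C T ≤ C U :=
    AddCon.addConGen_mono fun _ _ ⟨i, hi, hR⟩ => ⟨i, hTU hi, hR⟩
  have exists_common {x y x' y' : M} :
      (∃ T : Finset ι, ↑T ⊆ S ∧ C T x y) → (∃ T : Finset ι, ↑T ⊆ S ∧ C T x' y') →
        ∃ T : Finset ι, ↑T ⊆ S ∧ C T x y ∧ C T x' y' := by
    rintro ⟨T, hTS, hT⟩ ⟨U, hUS, hU⟩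
    exact ⟨T ∪ U, by simpa using ⟨hTS, hUS⟩, C_mono Finset.subset_union_left hT,
      C_mono Finset.subset_union_right hU⟩
  replace h : AddConGen.Rel (fun x y => ∃ i ∈ S, R i x y) x y := h
  induction h with
  | of x y hxy =>
    obtain ⟨i, hi, hR⟩ := hxy
    exact ⟨{i}, by simpa using hi, AddCon.le_addConGen _ _ ⟨i, by simp, hR⟩⟩
  | refl x => exact ⟨∅, by simp, AddCon.refl _ x⟩
  | symm _ ih =>
    obtain ⟨T, hTS, hT⟩ := ih
    exact ⟨T, hTS, (C T).symm hT⟩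
  | trans _ _ ih₁ ih₂ =>
    obtain ⟨T, hTS, hT₁, hT₂⟩ := exists_common ih₁ ih₂
    exact ⟨T, hTS, (C T).trans hT₁ hT₂⟩
  | add _ _ ih₁ ih₂ =>
    obtain ⟨T, hTS, hT₁, hT₂⟩ := exists_common ih₁ ih₂
    exact ⟨T, hTS, (C T).add hT₁ hT₂⟩

/-- The congruence on the free abelian monoid `V →₀ ℕ` generated by the relations `v = out v`
for `v ∈ S`. For the vertices `S` emitting edges and the sums `out v` of the ranges of the edges
leaving `v`, its quotient is the graph monoid. The values of `out` off `S` are irrelevant. -/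
noncomputable def rewriteCon {V : Type*} (S : Set V) (out : V → V →₀ ℕ) : AddCon (V →₀ ℕ) :=
  addConGen fun x y => ∃ v ∈ S, x = Finsupp.single v 1 ∧ y = out v

/-- The substitution of `p` for the generator `v`, as an endomorphism of the free abelian monoid
on `V`. -/
noncomputable def substVertex {V : Type*} (v : V) (p : V →₀ ℕ) : (V →₀ ℕ) →+ (V →₀ ℕ) :=
  Finsupp.eraseAddHom v + (multiplesHom _ p).comp (Finsupp.applyAddHom v)

section RewriteCon

variable {V : Type*} {S : Set V} {out : V → V →₀ ℕ} {v : V}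

theorem rewriteCon_single (out : V → V →₀ ℕ) (hv : v ∈ S) :
    rewriteCon S out (Finsupp.single v 1) (out v) :=
  AddCon.le_addConGen _ _ ⟨v, hv, rfl, rfl⟩

theorem rewriteCon_le_iff {C : AddCon (V →₀ ℕ)} :
    rewriteCon S out ≤ C ↔ ∀ v ∈ S, C (Finsupp.single v 1) (out v) := by
  refine AddCon.addConGen_le.trans ⟨fun h v hv => h _ _ ⟨v, hv, rfl, rfl⟩, ?_⟩
  rintro h _ _ ⟨v, hv, rfl, rfl⟩
  exact h v hv

theorem rewriteCon_mono {T : Set V} (hST : S ⊆ T) (out : V → V →₀ ℕ) :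
    rewriteCon S out ≤ rewriteCon T out :=
  rewriteCon_le_iff.2 fun _ hv => rewriteCon_single out (hST hv)

theorem rewriteCon_add_tsub (hv : v ∈ S) (hloop : Finsupp.single v 1 ≤ out v) {x : V →₀ ℕ}
    (hx : Finsupp.single v 1 ≤ x) :
    rewriteCon S out x (x + (out v - Finsupp.single v 1)) := by
  obtain ⟨c, rfl⟩ := exists_add_of_le hx
  rw [add_right_comm, add_tsub_cancel_of_le hloop]
  exact (rewriteCon S out).add (rewriteCon_single out hv) ((rewriteCon S out).refl c)

theorem exists_le_nsmul_iff_of_rewriteCon (hloop : ∀ v ∈ S, Finsupp.single v 1 ≤ out v)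
    (b : V →₀ ℕ) (n : ℕ) {x y : V →₀ ℕ} (hxy : rewriteCon S out x y) :
    (∃ c, rewriteCon S out b c ∧ x ≤ n • c) ↔ ∃ c, rewriteCon S out b c ∧ y ≤ n • c := by
  refine iff_of_addConGen (P := fun x => ∃ c, rewriteCon S out b c ∧ x ≤ n • c) ?_ hxy
  rintro _ _ ⟨v, hv, rfl, rfl⟩ w
  constructor
  · rintro ⟨c, hbc, hle⟩
    have hpos : 0 < n * c v := by
      simpa [Nat.one_le_iff_ne_zero, Nat.pos_iff_ne_zero] using (le_self_add.trans hle) v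
    have hn : n ≠ 0 := (Nat.pos_of_mul_pos_right hpos).ne'
    have hvc : Finsupp.single v 1 ≤ c := Finsupp.single_le_iff.2 (Nat.pos_of_mul_pos_left hpos)
    refine ⟨c + (out v - Finsupp.single v 1),
      (rewriteCon S out).trans hbc (rewriteCon_add_tsub hv (hloop v hv) hvc), ?_⟩
    calc out v + w = Finsupp.single v 1 + w + (out v - Finsupp.single v 1) := by
          rw [add_right_comm, add_tsub_cancel_of_le (hloop v hv)]
      _ ≤ n • c + n • (out v - Finsupp.single v 1) :=
          add_le_add hle (le_self_nsmul zero_le hn)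
      _ = n • (c + (out v - Finsupp.single v 1)) := (nsmul_add _ _ _).symm
  · rintro ⟨c, hbc, hle⟩
    exact ⟨c, hbc, (add_le_add_left (hloop v hv) w).trans hle⟩

theorem isUnperforated_rewriteCon_of_loops (hloop : ∀ v ∈ S, Finsupp.single v 1 ≤ out v) :
    IsUnperforated (rewriteCon S out).Quotient := by
  refine isUnperforated_quotient_iff.2 fun a b z n hn hab => ?_
  obtain ⟨c, hbc, hle⟩ := (exists_le_nsmul_iff_of_rewriteCon hloop b n hab).1
    ⟨b, (rewriteCon S out).refl b, le_rfl⟩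
  have hac : a ≤ c := fun v =>
    Nat.le_of_mul_le_mul_left (by simpa using (le_self_add.trans hle) v) hn
  obtain ⟨z', rfl⟩ := exists_add_of_le hac
  exact ⟨z', hbc⟩

theorem substVertex_apply (v : V) (p x : V →₀ ℕ) :
    substVertex v p x = x.erase v + x v • p :=
  rfl

theorem substVertex_of_apply_eq_zero {x : V →₀ ℕ} (hx : x v = 0) (p : V →₀ ℕ) :
    substVertex v p x = x := by
  rw [substVertex_apply, hx, zero_nsmul, add_zero,
    Finsupp.erase_of_notMem_support (Finsupp.notMem_support_iff.2 hx)]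

theorem substVertex_single_self (v : V) (p : V →₀ ℕ) :
    substVertex v p (Finsupp.single v 1) = p := by
  simp [substVertex_apply]

theorem rewriteCon_substVertex (out : V → V →₀ ℕ) (hv : v ∈ S) (x : V →₀ ℕ) :
    rewriteCon S out x (substVertex v (out v) x) := by
  have hx : x = x.erase v + x v • Finsupp.single v 1 := by
    rw [Finsupp.smul_single_one, Finsupp.erase_add_single]
  rw [substVertex_apply]
  nth_rw 1 [hx]
  exact (rewriteCon S out).add ((rewriteCon S out).refl _)
    ((rewriteCon S out).nsmul _ (rewriteCon_single out hv))

theorem rewriteCon_sdiff_singleton_le (out : V → V →₀ ℕ) (hv : v ∈ S) :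
    rewriteCon (S \ {v}) (substVertex v (out v) ∘ out) ≤ rewriteCon S out :=
  rewriteCon_le_iff.2 fun u hu => (rewriteCon S out).trans (rewriteCon_single out hu.1)
    (rewriteCon_substVertex out hv (out u))

theorem rewriteCon_le_comap_substVertex (S : Set V) (hout : out v v = 0) :
    rewriteCon S out ≤ (rewriteCon (S \ {v}) (substVertex v (out v) ∘ out)).comap
      (substVertex v (out v)) (map_add _) := by
  refine rewriteCon_le_iff.2 fun u hu => ?_
  rw [AddCon.comap_rel]
  obtain rfl | huv := eq_or_ne u v
  · rw [substVertex_single_self, substVertex_of_apply_eq_zero hout]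
    exact AddCon.refl _ _
  · rw [substVertex_of_apply_eq_zero (Finsupp.single_eq_of_ne huv.symm)]
    exact rewriteCon_single (substVertex v (out v) ∘ out) ⟨hu, huv⟩

theorem isUnperforated_rewriteCon_of_substVertex (hv : v ∈ S) (hout : out v v = 0)
    (h : IsUnperforated (rewriteCon (S \ {v}) (substVertex v (out v) ∘ out)).Quotient) :
    IsUnperforated (rewriteCon S out).Quotient := by
  set C := rewriteCon S out
  set C' := rewriteCon (S \ {v}) (substVertex v (out v) ∘ out)
  let eliminate : C.Quotient →+ C'.Quotient :=
    C.lift (C'.mk'.comp (substVertex v (out v))) fun _ _ hxy =>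
      (AddCon.eq C').2 (rewriteCon_le_comap_substVertex S hout hxy)
  let restore : C'.Quotient →+ C.Quotient := C'.map C (rewriteCon_sdiff_singleton_le out hv)
  refine h.of_leftInverse (f := eliminate) (g := restore) fun x => ?_
  induction x using AddCon.induction_on with | _ x
  exact (AddCon.eq C).2 (C.symm (rewriteCon_substVertex out hv x))

theorem isUnperforated_rewriteCon_finset (S : Finset V) (out : V → V →₀ ℕ) :
    IsUnperforated (rewriteCon (S : Set V) out).Quotient := by
  classical
  induction S using Finset.strongInduction generalizing out with | H S ih
  by_cases hloop : ∀ v ∈ S, Finsupp.single v 1 ≤ out v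
  · exact isUnperforated_rewriteCon_of_loops hloop
  · push Not at hloop
    obtain ⟨v, hv, hle⟩ := hloop
    have hout : out v v = 0 := by simpa [Finsupp.single_le_iff] using hle
    refine isUnperforated_rewriteCon_of_substVertex hv hout ?_
    rw [← Finset.coe_erase]
    exact ih (S.erase v) (Finset.erase_ssubset hv) _

end RewriteCon

theorem proposition6p4_general {V : Type*} (S : Set V) (out : V → V →₀ ℕ) :
    IsUnperforated (rewriteCon S out).Quotient := by
  refine isUnperforated_quotient_iff.2 fun a b z n hn hab => ?_
  obtain ⟨T, hTS, habT⟩ := exists_finset_of_addConGen hab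
  obtain ⟨z', hz'⟩ :=
    isUnperforated_quotient_iff.1 (isUnperforated_rewriteCon_finset T out) hn habT
  exact ⟨z', rewriteCon_mono hTS out hz'⟩

theorem DirGraph.addConGen_graphRel {V Edge : Type*} (E : DirGraph V Edge) (hE : E.RowFinite) :
    addConGen (GraphRel E hE) = rewriteCon {x | E.Emits x} (E.outSum hE) := by
  refine le_antisymm (AddCon.addConGen_le.2 ?_) (rewriteCon_le_iff.2 fun x hx => ?_)
  · rintro _ _ ⟨x, hx⟩
    exact rewriteCon_single (E.outSum hE) hx
  · exact AddCon.le_addConGen _ _ (.of_emits x hx)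

theorem proposition6p4 {V : Type u} {Edge : Type v} (E : DirGraph V Edge) (hE : E.RowFinite) :
    IsUnperforated (E.graphMonoid hE) := by
  change IsUnperforated (addConGen (DirGraph.GraphRel E hE)).Quotient
  exact E.addConGen_graphRel hE ▸ proposition6p4_general _ _
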